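/- Let $V$ be the $5$-dimensional space of real symmetric $3\times 3$ matrices $\sigma=(\sigma_{kl})$ with $\sigma_{22}=\sigma_{13}+\sigma_{31}$. With $E_{kl}$ the matrix units, let $$\sigma_1=2E_{11},\quad \sigma_2=E_{12}+E_{21},\quad \sigma_3=E_{13}+2E_{22}+E_{31},\quad \sigma_4=E_{23}+E_{32},\quad \sigma_5=2E_{33},$$ which form a basis of $V$. Let $W\subset\wedge^2V$ be the subspace spanned by $$\sigma_1\wedge\sigma_4-\sigma_2\wedge\sigma_3,\qquad \sigma_1\wedge\sigma_5-\sigma_2\wedge\sigma_4,\qquad \sigma_2\wedge\sigma_5-\sigma_3\wedge\sigma_4 .$$ Let $\mathfrak g=V\oplus(\wedge^2V)/W$ be the real Lie algebra with bracket $[(v,a),(w,b)]=(0,\;v\wedge w \bmod W)$. It is $2$-step nilpotent and $12$-dimensional. Let $G$ be the simply connected Lie group with Lie algebra $\mathfrak g$, that is, $\mathfrak g$ with its standard manifold structure and the product $x\cdot y=x+y+\tfrac12[x,y]$; this is a simply connected Lie group whose Lie algebra is isomorphic to $\mathfrak g$. Then the action on $G$ of the group $\mathrm{Aut}(G)$ of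 continuous automorphisms of $G$ has no dense orbit: for every $g\in G$ the set $\{\varphi(g):\varphi\in\mathrm{Aut}(G)\}$ is not dense in $G$. -/

import Mathlib

open scoped Manifold ContDiff

noncomputable section

namespace TwoStep

theorem update_pair_zero {X : Type} (a b x : X) : Function.update ![a, b] 0 x = ![x, b] := by
  ext i; fin_cases i <;> rfl

theorem update_pair_one {X : Type} (a b x : X) : Function.update ![a, b] 1 x = ![a, x] := by
  ext i; fin_cases i <;> rfl

section General

variable (V : Type) [AddCommGroup V] [Module ℝ V] (W : Submodule ℝ (⋀[ℝ]^2 V))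

/-- The underlying space `V ⊕ (⋀² V) / W` of the 2-step nilpotent Lie algebra attached to a
real vector space `V` and a subspace `W` of its second exterior power. -/
def Alg : Type := V × ((⋀[ℝ]^2 V) ⧸ W)

instance : AddCommGroup (Alg V W) := inferInstanceAs (AddCommGroup (V × ((⋀[ℝ]^2 V) ⧸ W)))

instance : Module ℝ (Alg V W) := inferInstanceAs (Module ℝ (V × ((⋀[ℝ]^2 V) ⧸ W)))

variable {V}

/-- The wedge product `v ∧ w` in the second exterior power of `V`. -/
def wedge (v w : V) : ⋀[ℝ]^2 V := exteriorPower.ιMulti ℝ 2 ![v, w]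

/-- The wedge product as a bilinear map. -/
def wedgeBilin : V →ₗ[ℝ] V →ₗ[ℝ] ⋀[ℝ]^2 V :=
  LinearMap.mk₂ ℝ wedge
    (fun a b c => by
      have := (exteriorPower.ιMulti ℝ 2 (M := V)).map_update_add ![a, c] 0 a b
      simpa only [update_pair_zero, wedge] using this)
    (fun r a b => by
      have := (exteriorPower.ιMulti ℝ 2 (M := V)).map_update_smul ![a, b] 0 r a
      simpa only [update_pair_zero, wedge] using this)
    (fun a b c => by
      have := (exteriorPower.ιMulti ℝ 2 (M := V)).map_update_add ![a, c] 1 b c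
      simpa only [update_pair_one, wedge] using this)
    (fun r a b => by
      have := (exteriorPower.ιMulti ℝ 2 (M := V)).map_update_smul ![a, b] 1 r b
      simpa only [update_pair_one, wedge] using this)

/-- `(v, w) ↦ v ∧ w mod W` as a bilinear map. -/
def wedgeModBilin : V →ₗ[ℝ] V →ₗ[ℝ] ((⋀[ℝ]^2 V) ⧸ W) := wedgeBilin.compr₂ W.mkQ

theorem wedgeModBilin_apply (v w : V) :
    wedgeModBilin W v w = W.mkQ (wedge v w) := rfl

theorem wedgeModBilin_self (v : V) : wedgeModBilin W v v = 0 := by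
  have : wedge v v = 0 :=
    (exteriorPower.ιMulti ℝ 2 (M := V)).map_eq_zero_of_eq ![v, v] (i := 0) (j := 1) rfl (by decide)
  rw [wedgeModBilin_apply, this, map_zero]

/-- The bracket: `[(v, a), (w, b)] = (0, v ∧ w mod W)`. -/
instance : Bracket (Alg V W) (Alg V W) where
  bracket x y := ((0 : V), wedgeModBilin W x.1 y.1)

theorem bracket_eq (x y : Alg V W) : ⁅x, y⁆ = ((0 : V), wedgeModBilin W x.1 y.1) := rfl

instance : LieRing (Alg V W) where
  add_lie x y z := by
    refine Prod.ext (add_zero (0 : V)).symm ?_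
    exact LinearMap.map_add₂ (wedgeModBilin W) x.1 y.1 z.1
  lie_add x y z := by
    refine Prod.ext (add_zero (0 : V)).symm ?_
    exact (wedgeModBilin W x.1).map_add y.1 z.1
  lie_self x := Prod.ext rfl (wedgeModBilin_self W x.1)
  leibniz_lie x y z := by
    have h : ∀ u : V, wedgeModBilin W u 0 = 0 := fun u => map_zero _
    have h' : ∀ u : V, wedgeModBilin W 0 u = 0 := fun u => LinearMap.map_zero₂ _ u
    refine Prod.ext (add_zero (0 : V)).symm ?_
    change wedgeModBilin W x.1 0 = wedgeModBilin W 0 z.1 + wedgeModBilin W y.1 0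
    rw [h, h, h', add_zero]

instance : LieAlgebra ℝ (Alg V W) where
  lie_smul t x y := by
    refine Prod.ext (smul_zero t).symm ?_
    exact (wedgeModBilin W x.1).map_smul t y.1

theorem lie_lie_eq_zero (x y z : Alg V W) : ⁅x, ⁅y, z⁆⁆ = 0 :=
  Prod.ext rfl (map_zero (wedgeModBilin W x.1))

theorem lie_lie_eq_zero' (x y z : Alg V W) : ⁅⁅x, y⁆, z⁆ = 0 :=
  Prod.ext rfl (LinearMap.map_zero₂ (wedgeModBilin W) z.1)

variable (V)

/-- The group attached to the Lie algebra `Alg V W`: the same underlying space, with the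
Baker-Campbell-Hausdorff product `x * y = x + y + ½ [x, y]` (all further terms of the series vanish
in a 2-step nilpotent Lie algebra). -/
def Grp : Type := Alg V W

variable {V}

/-- The exponential map, which is the identity in these coordinates. -/
def exp : Alg V W ≃ Grp V W := Equiv.refl _

/-- The logarithm, which is the identity in these coordinates. -/
def log : Grp V W ≃ Alg V W := Equiv.refl _

instance : Group (Grp V W) where
  mul x y := exp W (log W x + log W y + (1 / 2 : ℝ) • ⁅log W x, log W y⁆)
  one := exp W 0
  inv x := exp W (-log W x)
  mul_assoc x y z := by
    change (log W x + log W y + (1 / 2 : ℝ) • ⁅log W x, log W y⁆) + log W z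
        + (1 / 2 : ℝ) • ⁅log W x + log W y + (1 / 2 : ℝ) • ⁅log W x, log W y⁆, log W z⁆
      = log W x + (log W y + log W z + (1 / 2 : ℝ) • ⁅log W y, log W z⁆)
        + (1 / 2 : ℝ) • ⁅log W x, log W y + log W z + (1 / 2 : ℝ) • ⁅log W y, log W z⁆⁆
    simp only [add_lie, lie_add, smul_lie, lie_smul, lie_lie_eq_zero, lie_lie_eq_zero', smul_zero,
      smul_add, add_zero]
    abel
  one_mul x := by
    change (0 : Alg V W) + log W x + (1 / 2 : ℝ) • ⁅(0 : Alg V W), log W x⁆ = log W x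
    simp
  mul_one x := by
    change log W x + (0 : Alg V W) + (1 / 2 : ℝ) • ⁅log W x, (0 : Alg V W)⁆ = log W x
    simp
  inv_mul_cancel x := by
    change -log W x + log W x + (1 / 2 : ℝ) • ⁅-log W x, log W x⁆ = 0
    simp

theorem mul_eq (x y : Grp V W) :
    x * y = exp W (log W x + log W y + (1 / 2 : ℝ) • ⁅log W x, log W y⁆) := rfl

variable [FiniteDimensional ℝ V]

instance : FiniteDimensional ℝ (Alg V W) :=
  inferInstanceAs (FiniteDimensional ℝ (V × ((⋀[ℝ]^2 V) ⧸ W)))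

/-- A norm on the finite-dimensional space `Alg V W`, the maximum norm in some basis. All norms on
it are equivalent, so its topology and its smooth structure do not depend on the choice. -/
instance : NormedAddCommGroup (Alg V W) :=
  NormedAddCommGroup.induced (Alg V W) (Fin (Module.finrank ℝ (Alg V W)) → ℝ)
    (Module.finBasis ℝ (Alg V W)).equivFun (Module.finBasis ℝ (Alg V W)).equivFun.injective

instance : NormedSpace ℝ (Alg V W) :=
  NormedSpace.induced ℝ (Alg V W) (Fin (Module.finrank ℝ (Alg V W)) → ℝ)
    (Module.finBasis ℝ (Alg V W)).equivFun.toLinearMap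

/-- The group carries the topology of the real vector space `Alg V W` ... -/
instance : TopologicalSpace (Grp V W) := inferInstanceAs (TopologicalSpace (Alg V W))

/-- ... and its standard manifold structure. -/
instance : ChartedSpace (Alg V W) (Grp V W) := inferInstanceAs (ChartedSpace (Alg V W) (Alg V W))

instance (n : WithTop ℕ∞) : IsManifold 𝓘(ℝ, Alg V W) n (Grp V W) :=
  inferInstanceAs (IsManifold 𝓘(ℝ, Alg V W) n (Alg V W))

/-- The bracket as a bilinear map. -/
def lieBilin : Alg V W →ₗ[ℝ] Alg V W →ₗ[ℝ] Alg V W :=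
  LinearMap.mk₂ ℝ (fun x y => ⁅x, y⁆) add_lie smul_lie lie_add lie_smul

theorem contDiff_lie (n : WithTop ℕ∞) :
    ContDiff ℝ n (fun p : Alg V W × Alg V W => ⁅p.1, p.2⁆) := by
  let B : Alg V W →L[ℝ] Alg V W →L[ℝ] Alg V W :=
    LinearMap.toContinuousLinearMap (LinearMap.toContinuousLinearMap.toLinearMap ∘ₗ lieBilin W)
  exact (B.contDiff.comp contDiff_fst).clm_apply contDiff_snd

theorem contDiff_mul_log (n : WithTop ℕ∞) :
    ContDiff ℝ n (fun p : Alg V W × Alg V W => p.1 + p.2 + (1 / 2 : ℝ) • ⁅p.1, p.2⁆) :=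
  (contDiff_fst.add contDiff_snd).add ((contDiff_lie W n).const_smul _)

/-- `Grp V W` is a Lie group (smooth, and even real analytic). -/
instance (n : WithTop ℕ∞) : LieGroup 𝓘(ℝ, Alg V W) n (Grp V W) where
  contMDiff_mul := by
    have h := (contDiff_mul_log W n).contMDiff
    rw [modelWithCornersSelf_prod, ← chartedSpaceSelf_prod] at h
    exact h
  contMDiff_inv := by
    have h : ContDiff ℝ n (fun x : Alg V W => -x) := contDiff_neg
    exact h.contMDiff

end General

/-- The 5-dimensional space of real symmetric `3 × 3` matrices with `σ₂₂ = σ₁₃ + σ₃₁`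
(indices start at `0` in the code). -/
def V : Submodule ℝ (Matrix (Fin 3) (Fin 3) ℝ) where
  carrier := {σ | σ.IsSymm ∧ σ 1 1 = σ 0 2 + σ 2 0}
  add_mem' := by
    rintro a b ⟨ha, ha'⟩ ⟨hb, hb'⟩
    refine ⟨ha.add hb, ?_⟩
    simp only [Matrix.add_apply, ha', hb']
    ring
  zero_mem' := ⟨Matrix.isSymm_zero, by simp⟩
  smul_mem' := by
    rintro c a ⟨ha, ha'⟩
    refine ⟨ha.smul c, ?_⟩
    simp only [Matrix.smul_apply, ha', smul_add]

theorem mem_V (σ : Matrix (Fin 3) (Fin 3) ℝ) :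
    σ ∈ V ↔ σ.IsSymm ∧ σ 1 1 = σ 0 2 + σ 2 0 := Iff.rfl

def σ₁ : V := ⟨!![2, 0, 0; 0, 0, 0; 0, 0, 0], by
  rw [mem_V, Matrix.IsSymm.ext_iff]; simp [Fin.forall_fin_succ]⟩

def σ₂ : V := ⟨!![0, 1, 0; 1, 0, 0; 0, 0, 0], by
  rw [mem_V, Matrix.IsSymm.ext_iff]; simp [Fin.forall_fin_succ]⟩

def σ₃ : V := ⟨!![0, 0, 1; 0, 2, 0; 1, 0, 0], by
  rw [mem_V, Matrix.IsSymm.ext_iff]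
  refine ⟨by simp [Fin.forall_fin_succ], ?_⟩
  change (2 : ℝ) = 1 + 1
  norm_num⟩

def σ₄ : V := ⟨!![0, 0, 0; 0, 0, 1; 0, 1, 0], by
  rw [mem_V, Matrix.IsSymm.ext_iff]; simp [Fin.forall_fin_succ]⟩

def σ₅ : V := ⟨!![0, 0, 0; 0, 0, 0; 0, 0, 2], by
  rw [mem_V, Matrix.IsSymm.ext_iff]; simp [Fin.forall_fin_succ]⟩

/-- The 3-dimensional subspace `W` of `⋀² V`. -/
def W : Submodule ℝ (⋀[ℝ]^2 V) :=
  Submodule.span ℝ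
    {wedge σ₁ σ₄ - wedge σ₂ σ₃, wedge σ₁ σ₅ - wedge σ₂ σ₄, wedge σ₂ σ₅ - wedge σ₃ σ₄}

/-- The Lie algebra `V ⊕ (⋀² V) / W`. -/
abbrev 𝔤 : Type := Alg V W

/-- The simply connected nilpotent Lie group with Lie algebra `𝔤`. -/
abbrev G : Type := Grp V W

end TwoStep

end

noncomputable section

namespace TwoStep

/-! ### From continuous group endomorphisms to linear maps of `V` preserving `W`. -/

section General

variable {V : Type} [AddCommGroup V] [Module ℝ V] (W : Submodule ℝ (⋀[ℝ]^2 V))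

/-! A continuous automorphism of the group is a Lie algebra automorphism in exponential coordinates
(`toLieHom`). It induces an invertible linear map `A` of `V`, and `∧²A` preserves `W`
(`map_linearPart_mem`). For `v ∈ V` consider the quadratic form `w ↦ w ∧ w ∧ v` on `W`, valued in
`∧⁵V ≅ ℝ`. Replacing `v` by `A v` and `w` by `∧²A w` multiplies it by `det A` (`quad_map`), so
whether it has a nontrivial zero on `W` depends only on the orbit of `v`
(`anisotropic_of_anisotropic_map`). The form is computed explicitly in `quad_elemW`. It is definite
for all `v` near `σ₁ + σ₃ + σ₅` (`anisotropic_of_coords`) and isotropic on a nonempty open set of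
`v` (`not_anisotropic_of_coords`). A dense orbit would meet both open sets, which is impossible. -/

theorem lie_eq_zero_of_mul_comm {x y : Grp V W} (h : x * y = y * x) :
    ⁅log W x, log W y⁆ = 0 := by
  have h' : log W x + log W y + (1 / 2 : ℝ) • ⁅log W x, log W y⁆
      = log W y + log W x + (1 / 2 : ℝ) • ⁅log W y, log W x⁆ := h
  rw [← lie_skew (log W y) (log W x), add_comm (log W y), smul_neg, add_right_inj,
    eq_neg_iff_add_eq_zero, ← add_smul] at h'
  norm_num at h'
  exact h'

theorem exp_mul_exp_of_lie_eq_zero {x y : Alg V W} (h : ⁅x, y⁆ = 0) :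
    exp W x * exp W y = exp W (x + y) := by
  change x + y + (1 / 2 : ℝ) • ⁅x, y⁆ = x + y
  rw [h, smul_zero, add_zero]

/-- This writes addition through products and a multiple of the bracket, so that a homomorphism
respecting brackets and scalars is additive. -/
theorem exp_add (x y : Alg V W) :
    exp W (x + y) = exp W x * exp W y * exp W ((-1 / 2 : ℝ) • ⁅x, y⁆) := by
  change x + y = (x + y + (1 / 2 : ℝ) • ⁅x, y⁆) + (-1 / 2 : ℝ) • ⁅x, y⁆
    + (1 / 2 : ℝ) • ⁅x + y + (1 / 2 : ℝ) • ⁅x, y⁆, (-1 / 2 : ℝ) • ⁅x, y⁆⁆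
  rw [lie_smul, lie_lie_eq_zero, smul_zero, smul_zero, add_zero, add_assoc, ← add_smul]
  norm_num

/-- In a 2-step nilpotent group the group commutator is exactly the Lie bracket. Hence homomorphisms
respect brackets before any linearity is known. -/
theorem exp_lie (x y : Alg V W) :
    exp W ⁅x, y⁆ = exp W x * exp W y * (exp W y * exp W x)⁻¹ := by
  rw [eq_mul_inv_iff_mul_eq]
  change ⁅x, y⁆ + (y + x + (1 / 2 : ℝ) • ⁅y, x⁆)
    + (1 / 2 : ℝ) • ⁅⁅x, y⁆, y + x + (1 / 2 : ℝ) • ⁅y, x⁆⁆ = x + y + (1 / 2 : ℝ) • ⁅x, y⁆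
  rw [lie_lie_eq_zero', ← lie_skew x y]
  module

/-- The projection of `Alg V W` onto its first summand. -/
def proj : Alg V W →ₗ[ℝ] V := LinearMap.fst ℝ V ((⋀[ℝ]^2 V) ⧸ W)

/-- The inclusion of the first summand into `Alg V W`. -/
def incl : V →ₗ[ℝ] Alg V W := LinearMap.inl ℝ V ((⋀[ℝ]^2 V) ⧸ W)

/-- The inclusion of the second summand into `Alg V W`. -/
def inclSnd : ((⋀[ℝ]^2 V) ⧸ W) →ₗ[ℝ] Alg V W := LinearMap.inr ℝ V ((⋀[ℝ]^2 V) ⧸ W)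

/-- The projection of `Alg V W` onto its second summand. -/
def projSnd : Alg V W →ₗ[ℝ] ((⋀[ℝ]^2 V) ⧸ W) := LinearMap.snd ℝ V ((⋀[ℝ]^2 V) ⧸ W)

theorem proj_lie (x y : Alg V W) : proj W ⁅x, y⁆ = 0 := rfl

theorem incl_proj_add (x : Alg V W) : incl W (proj W x) + inclSnd W (projSnd W x) = x :=
  Prod.ext (add_zero _) (zero_add _)

theorem inclSnd_mkQ_ιMulti (a : Fin 2 → V) :
    inclSnd W (W.mkQ (exteriorPower.ιMulti ℝ 2 a)) = ⁅incl W (a 0), incl W (a 1)⁆ := by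
  have : a = ![a 0, a 1] := by ext i; fin_cases i <;> rfl
  conv_lhs => rw [this]
  rfl

/-- Each element of the second summand is a linear combination of brackets. -/
theorem inclSnd_mem_span_lie (z : (⋀[ℝ]^2 V) ⧸ W) :
    inclSnd W z ∈ Submodule.span ℝ (Set.range fun p : Alg V W × Alg V W => ⁅p.1, p.2⁆) := by
  obtain ⟨w, rfl⟩ := W.mkQ_surjective z
  have hw : w ∈ Submodule.span ℝ (Set.range (exteriorPower.ιMulti ℝ 2 (M := V))) := by
    rw [exteriorPower.ιMulti_span]; trivial
  induction hw using Submodule.span_induction with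
  | mem x hx =>
    obtain ⟨a, rfl⟩ := hx
    exact Submodule.subset_span ⟨(incl W (a 0), incl W (a 1)), (inclSnd_mkQ_ιMulti W a).symm⟩
  | zero => rw [map_zero, map_zero]; exact zero_mem _
  | add x y _ _ hx hy => rw [map_add, map_add]; exact add_mem hx hy
  | smul c x _ hx => rw [map_smul, map_smul]; exact Submodule.smul_mem _ _ hx

variable {W}

/-- A Lie algebra homomorphism maps the second summand to itself. -/
theorem proj_map_inclSnd (f : Alg V W →ₗ⁅ℝ⁆ Alg V W) (z : (⋀[ℝ]^2 V) ⧸ W) :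
    proj W (f (inclSnd W z)) = 0 := by
  have h := inclSnd_mem_span_lie W z
  have : Submodule.span ℝ (Set.range fun p : Alg V W × Alg V W => ⁅p.1, p.2⁆)
      ≤ LinearMap.ker (proj W ∘ₗ (f : Alg V W →ₗ[ℝ] Alg V W)) := by
    rw [Submodule.span_le]
    rintro _ ⟨p, rfl⟩
    change proj W (f ⁅p.1, p.2⁆) = 0
    rw [LieHom.map_lie, proj_lie]
  exact this h

/-- The linear map of `V` induced by a Lie algebra homomorphism. -/
def linearPart (f : Alg V W →ₗ⁅ℝ⁆ Alg V W) : V →ₗ[ℝ] V :=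
  proj W ∘ₗ (f : Alg V W →ₗ[ℝ] Alg V W) ∘ₗ incl W

theorem linearPart_proj (f : Alg V W →ₗ⁅ℝ⁆ Alg V W) (x : Alg V W) :
    linearPart f (proj W x) = proj W (f x) := by
  conv_rhs => rw [← incl_proj_add W x, map_add, map_add, proj_map_inclSnd, add_zero]
  rfl

/-- On the second summand `f` is induced by `∧²` of its linear part, as one checks on decomposable
elements, where both sides are brackets. Since `W` is zero in the quotient, its image is too. -/
theorem map_linearPart_mem (f : Alg V W →ₗ⁅ℝ⁆ Alg V W) {w : ⋀[ℝ]^2 V} (hw : w ∈ W) :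
    exteriorPower.map 2 (linearPart f) w ∈ W := by
  have key : inclSnd W ∘ₗ W.mkQ ∘ₗ exteriorPower.map 2 (linearPart f)
      = (f : Alg V W →ₗ[ℝ] Alg V W) ∘ₗ inclSnd W ∘ₗ W.mkQ := by
    refine exteriorPower.linearMap_ext (AlternatingMap.ext fun a => ?_)
    simp only [LinearMap.compAlternatingMap_apply, LinearMap.comp_apply,
      exteriorPower.map_apply_ιMulti]
    rw [inclSnd_mkQ_ιMulti, inclSnd_mkQ_ιMulti]
    change _ = f _
    rw [LieHom.map_lie]
    rfl
  have h := LinearMap.congr_fun key w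
  simp only [LinearMap.comp_apply] at h
  rw [show W.mkQ w = 0 from (Submodule.Quotient.mk_eq_zero W).2 hw, map_zero, map_zero] at h
  exact (Submodule.Quotient.mk_eq_zero W).1 (congrArg Prod.snd h)

theorem map_exp_lie (φ : Grp V W →* Grp V W) (x y : Alg V W) :
    log W (φ (exp W ⁅x, y⁆)) = ⁅log W (φ (exp W x)), log W (φ (exp W y))⁆ := by
  rw [exp_lie, map_mul φ, map_inv φ, map_mul φ, map_mul φ]
  exact (congrArg (log W) (exp_lie W (log W (φ (exp W x))) (log W (φ (exp W y))))).symm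

variable [FiniteDimensional ℝ V]

theorem continuous_log : Continuous (log W) := continuous_id

theorem continuous_exp : Continuous (exp W) := continuous_id

/-- A continuous endomorphism of the group is linear on lines through the origin. -/
theorem map_exp_smul (φ : Grp V W →* Grp V W) (hφ : Continuous φ) (t : ℝ) (x : Alg V W) :
    log W (φ (exp W (t • x))) = t • log W (φ (exp W x)) := by
  have hc : ∀ s t : ℝ, exp W (s • x) * exp W (t • x) = exp W ((s + t) • x) := fun s t => by
    rw [exp_mul_exp_of_lie_eq_zero, add_smul]
    rw [smul_lie, lie_smul, lie_self, smul_zero, smul_zero]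
  let F : ℝ →+ Alg V W :=
    { toFun := fun t => log W (φ (exp W (t • x)))
      map_zero' := by
        rw [zero_smul]
        exact congrArg (log W) (map_one φ)
      map_add' := fun s t => by
        -- The images commute, so their bracket vanishes and their product is a sum of logarithms.
        -- Additivity in `t` and continuity then give real linearity.
        have h1 : φ (exp W (s • x)) * φ (exp W (t • x))
            = φ (exp W (t • x)) * φ (exp W (s • x)) := by
          rw [← map_mul φ, ← map_mul φ, hc, hc, add_comm]
        have h2 := exp_mul_exp_of_lie_eq_zero W (lie_eq_zero_of_mul_comm W h1)
        rw [← hc, map_mul φ]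
        exact congrArg (log W) h2 }
  have hF : Continuous F :=
    continuous_log.comp (hφ.comp (continuous_exp.comp (continuous_id.smul continuous_const)))
  have := map_real_smul F hF t 1
  rw [smul_eq_mul, mul_one] at this
  change log W (φ (exp W (t • x))) = t • log W (φ (exp W ((1 : ℝ) • x))) at this
  rwa [one_smul] at this

/-- The Lie algebra homomorphism attached to a continuous endomorphism of the group. -/
def toLieHom (φ : Grp V W →* Grp V W) (hφ : Continuous φ) : Alg V W →ₗ⁅ℝ⁆ Alg V W where
  toFun x := log W (φ (exp W x))
  map_add' x y := by
    rw [exp_add, map_mul φ, map_mul φ]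
    have h := exp_add W (log W (φ (exp W x))) (log W (φ (exp W y)))
    rw [← map_exp_lie, ← map_exp_smul φ hφ] at h
    exact (congrArg (log W) h).symm
  map_smul' t x := map_exp_smul φ hφ t x
  map_lie' := map_exp_lie φ _ _

instance : SimplyConnectedSpace (Grp V W) :=
  inferInstanceAs (SimplyConnectedSpace (Alg V W))

end General

/-! ### The Lie algebra of left-invariant vector fields. -/

section General
variable {V : Type} [AddCommGroup V] [Module ℝ V] (W : Submodule ℝ (⋀[ℝ]^2 V))
variable [FiniteDimensional ℝ V]

/-- The bracket as a continuous bilinear map. -/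
def lieCLM : Alg V W →L[ℝ] Alg V W →L[ℝ] Alg V W :=
  LinearMap.toContinuousLinearMap (LinearMap.toContinuousLinearMap.toLinearMap ∘ₗ lieBilin W)

theorem lieCLM_apply (x y : Alg V W) : lieCLM W x y = ⁅x, y⁆ := rfl

theorem mulInvariantVectorField_eq (v : Alg V W) :
    (mulInvariantVectorField (I := 𝓘(ℝ, Alg V W)) (G := Grp V W) v : Alg V W → Alg V W)
      = fun g : Alg V W => v + (1 / 2 : ℝ) • (lieCLM W).flip v g := by
  refine funext fun g : Alg V W => ?_
  have h : HasFDerivAt (fun x : Alg V W => g + x + (1 / 2 : ℝ) • lieCLM W g x)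
      (ContinuousLinearMap.id ℝ (Alg V W) + (1 / 2 : ℝ) • lieCLM W g) 0 :=
    ((hasFDerivAt_id _).const_add g).add ((lieCLM W g).hasFDerivAt.const_smul (1 / 2 : ℝ))
  have h2 := congrArg (fun L : Alg V W →L[ℝ] Alg V W => L v)
    ((mfderiv_eq_fderiv (𝕜 := ℝ) (f := fun x : Alg V W => g + x + (1 / 2 : ℝ) • lieCLM W g x)
      (x := 0)).trans h.fderiv)
  exact h2

/-- At the origin the two derivative terms are `½[v, w]` and `-½[w, v]`, which add up to the
bracket. -/
theorem lieBracket_add_half_lie (v w : Alg V W) :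
    VectorField.lieBracket ℝ (fun g : Alg V W => v + (1 / 2 : ℝ) • (lieCLM W).flip v g)
      (fun g : Alg V W => w + (1 / 2 : ℝ) • (lieCLM W).flip w g) 0 = ⁅v, w⁆ := by
  have hd : ∀ u : Alg V W, HasFDerivAt (fun g : Alg V W => u + (1 / 2 : ℝ) • (lieCLM W).flip u g)
      ((1 / 2 : ℝ) • (lieCLM W).flip u) 0 := fun u =>
    (((lieCLM W).flip u).hasFDerivAt.const_smul (1 / 2 : ℝ)).const_add u
  rw [VectorField.lieBracket, (hd v).fderiv, (hd w).fderiv]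
  simp only [map_zero, smul_zero, add_zero, smul_apply,
    ContinuousLinearMap.flip_apply, lieCLM_apply]
  rw [← lie_skew w v]
  module

theorem mlieBracket_eq_lieBracket {E : Type*} [NormedAddCommGroup E] [NormedSpace ℝ E]
    (X Y : Π x : E, TangentSpace 𝓘(ℝ, E) x) :
    VectorField.mlieBracket 𝓘(ℝ, E) X Y = VectorField.lieBracket ℝ X Y := by
  rw [← VectorField.mlieBracketWithin_univ, VectorField.mlieBracketWithin_eq_lieBracketWithin]
  exact VectorField.lieBracketWithin_univ

theorem groupLieAlgebra_lie (v w : GroupLieAlgebra 𝓘(ℝ, Alg V W) (Grp V W)) :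
    ⁅v, w⁆ = @Bracket.bracket (Alg V W) (Alg V W) _ v w := by
  refine (congrFun (mlieBracket_eq_lieBracket (E := Alg V W) _ _) 0).trans ?_
  refine Eq.trans ?_ (lieBracket_add_half_lie W v w)
  exact congrArg₂ (fun X Y : Alg V W → Alg V W => VectorField.lieBracket ℝ X Y 0)
    (mulInvariantVectorField_eq W v) (mulInvariantVectorField_eq W w)

/-- The Lie algebra of the Lie group `Grp V W` is `Alg V W`. -/
def groupLieAlgebraEquiv : GroupLieAlgebra 𝓘(ℝ, Alg V W) (Grp V W) ≃ₗ⁅ℝ⁆ Alg V W :=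
  { LinearEquiv.refl ℝ (Alg V W) with
    map_lie' := fun {v w} => groupLieAlgebra_lie W v w }

end General

/-! ### The quadratic form with values in the top exterior power. -/

/-- Coordinates on `V` with respect to `σ₁, …, σ₅`. -/
def coords : V ≃ₗ[ℝ] (Fin 5 → ℝ) where
  toFun v := ![v.1 0 0 / 2, v.1 0 1, v.1 0 2, v.1 1 2, v.1 2 2 / 2]
  map_add' v w := by
    ext i; fin_cases i <;> simp [add_div]
  map_smul' c v := by
    ext i; fin_cases i <;> simp [mul_div_assoc]
  invFun t := ⟨!![2 * t 0, t 1, t 2; t 1, 2 * t 2, t 3; t 2, t 3, 2 * t 4], by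
    rw [mem_V, Matrix.IsSymm.ext_iff]
    refine ⟨by simp [Fin.forall_fin_succ], ?_⟩
    change 2 * t 2 = t 2 + t 2
    ring⟩
  left_inv v := by
    obtain ⟨v, hs, hv⟩ := v
    have h := hs.apply
    rw [h 0 2] at hv
    ext i j
    fin_cases i <;> fin_cases j <;> simp [h 0 1, h 0 2, h 1 2, hv] <;> ring
  right_inv t := by
    ext i; fin_cases i <;> simp

theorem coords_σ₁ : coords σ₁ = ![1, 0, 0, 0, 0] := by
  ext i; fin_cases i <;> simp [coords, σ₁]

theorem coords_σ₂ : coords σ₂ = ![0, 1, 0, 0, 0] := by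
  ext i; fin_cases i <;> simp [coords, σ₂]

theorem coords_σ₃ : coords σ₃ = ![0, 0, 1, 0, 0] := by
  ext i; fin_cases i <;> simp [coords, σ₃]

theorem coords_σ₄ : coords σ₄ = ![0, 0, 0, 1, 0] := by
  ext i; fin_cases i <;> simp [coords, σ₄]

theorem coords_σ₅ : coords σ₅ = ![0, 0, 0, 0, 1] := by
  ext i; fin_cases i <;> simp [coords, σ₅]

/-- The basis `σ₁, …, σ₅` of `V`. -/
def basisV : Module.Basis (Fin 5) ℝ V := Module.Basis.ofEquivFun coords

/-- The linear form on the exterior algebra of `V` that is the determinant in degree `5` and zero in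
all other degrees. -/
def volForm : ExteriorAlgebra ℝ V →ₗ[ℝ] ℝ :=
  ExteriorAlgebra.liftAlternating (Pi.single 5 basisV.det)

theorem volForm_map (A : V →ₗ[ℝ] V) (x : ExteriorAlgebra ℝ V) :
    volForm (ExteriorAlgebra.map A x) = LinearMap.det A * volForm x := by
  have : volForm ∘ₗ (ExteriorAlgebra.map A).toLinearMap = LinearMap.det A • volForm := by
    refine ExteriorAlgebra.lhom_ext fun i => AlternatingMap.ext fun a => ?_
    simp only [LinearMap.compAlternatingMap_apply, LinearMap.comp_apply, AlgHom.toLinearMap_apply,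
      LinearMap.smul_apply, ExteriorAlgebra.map_apply_ιMulti, volForm,
      ExteriorAlgebra.liftAlternating_apply_ιMulti, smul_eq_mul]
    by_cases h : i = 5
    · subst h
      rw [Pi.single_eq_same, Module.Basis.det_comp]
    · rw [Pi.single_eq_of_ne h]
      simp
  exact LinearMap.congr_fun this x

theorem volForm_mul (a b c d e : V) :
    volForm ((wedge a b : ExteriorAlgebra ℝ V) * (wedge c d : ExteriorAlgebra ℝ V)
      * ExteriorAlgebra.ι ℝ e) = Matrix.det (Matrix.of ![coords a, coords b, coords c, coords d, coords e]) := by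
  have : (wedge a b : ExteriorAlgebra ℝ V) * (wedge c d : ExteriorAlgebra ℝ V)
      * ExteriorAlgebra.ι ℝ e = ExteriorAlgebra.ιMulti ℝ 5 ![a, b, c, d, e] := by
    simp [wedge, ExteriorAlgebra.ιMulti_apply, mul_assoc]
  rw [this, volForm, ExteriorAlgebra.liftAlternating_apply_ιMulti, Pi.single_eq_same,
    Module.Basis.det_apply, ← Matrix.det_transpose]
  congr 1
  ext i j
  fin_cases i <;> simp [Module.Basis.toMatrix_apply, basisV]

/-- The quadratic form `w ↦ w ∧ w ∧ v` on `⋀² V`. -/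
def quad (v : V) (w : ⋀[ℝ]^2 V) : ℝ :=
  volForm ((w : ExteriorAlgebra ℝ V) * (w : ExteriorAlgebra ℝ V) * ExteriorAlgebra.ι ℝ v)

theorem coe_exteriorPower_map (A : V →ₗ[ℝ] V) (w : ⋀[ℝ]^2 V) :
    (exteriorPower.map 2 A w : ExteriorAlgebra ℝ V) = ExteriorAlgebra.map A w := by
  have : (⋀[ℝ]^2 V).subtype ∘ₗ exteriorPower.map 2 A
      = (ExteriorAlgebra.map A).toLinearMap ∘ₗ (⋀[ℝ]^2 V).subtype := by
    refine exteriorPower.linearMap_ext (AlternatingMap.ext fun a => ?_)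
    simp only [LinearMap.compAlternatingMap_apply, LinearMap.comp_apply, Submodule.subtype_apply,
      exteriorPower.map_apply_ιMulti, exteriorPower.ιMulti_apply_coe, AlgHom.toLinearMap_apply,
      ExteriorAlgebra.map_apply_ιMulti]
  exact LinearMap.congr_fun this w

theorem quad_map (A : V →ₗ[ℝ] V) (v : V) (w : ⋀[ℝ]^2 V) :
    quad (A v) (exteriorPower.map 2 A w) = LinearMap.det A * quad v w := by
  rw [quad, quad, ← volForm_map, coe_exteriorPower_map, map_mul (ExteriorAlgebra.map A),
    map_mul (ExteriorAlgebra.map A),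
    ExteriorAlgebra.map_apply_ι]

/-- The general element of `W`. -/
def elemW (x y z : ℝ) : ⋀[ℝ]^2 V :=
  x • (wedge σ₁ σ₄ - wedge σ₂ σ₃) + y • (wedge σ₁ σ₅ - wedge σ₂ σ₄)
    + z • (wedge σ₂ σ₅ - wedge σ₃ σ₄)

theorem mem_W_iff (w : ⋀[ℝ]^2 V) : w ∈ W ↔ ∃ x y z, elemW x y z = w := by
  rw [W, Submodule.mem_span_triple]
  rfl

/-- Laplace expansion along the first two rows. -/
theorem det_fin_five (a b c d e : Fin 5 → ℝ) : Matrix.det (Matrix.of ![a, b, c, d, e])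
    = (a 0 * b 1 - a 1 * b 0) * ((c 2 * d 3 - c 3 * d 2) * e 4 - (c 2 * d 4 - c 4 * d 2) * e 3
        + (c 3 * d 4 - c 4 * d 3) * e 2)
      - (a 0 * b 2 - a 2 * b 0) * ((c 1 * d 3 - c 3 * d 1) * e 4 - (c 1 * d 4 - c 4 * d 1) * e 3
        + (c 3 * d 4 - c 4 * d 3) * e 1)
      + (a 0 * b 3 - a 3 * b 0) * ((c 1 * d 2 - c 2 * d 1) * e 4 - (c 1 * d 4 - c 4 * d 1) * e 2
        + (c 2 * d 4 - c 4 * d 2) * e 1)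
      - (a 0 * b 4 - a 4 * b 0) * ((c 1 * d 2 - c 2 * d 1) * e 3 - (c 1 * d 3 - c 3 * d 1) * e 2
        + (c 2 * d 3 - c 3 * d 2) * e 1)
      + (a 1 * b 2 - a 2 * b 1) * ((c 0 * d 3 - c 3 * d 0) * e 4 - (c 0 * d 4 - c 4 * d 0) * e 3
        + (c 3 * d 4 - c 4 * d 3) * e 0)
      - (a 1 * b 3 - a 3 * b 1) * ((c 0 * d 2 - c 2 * d 0) * e 4 - (c 0 * d 4 - c 4 * d 0) * e 2
        + (c 2 * d 4 - c 4 * d 2) * e 0)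
      + (a 1 * b 4 - a 4 * b 1) * ((c 0 * d 2 - c 2 * d 0) * e 3 - (c 0 * d 3 - c 3 * d 0) * e 2
        + (c 2 * d 3 - c 3 * d 2) * e 0)
      + (a 2 * b 3 - a 3 * b 2) * ((c 0 * d 1 - c 1 * d 0) * e 4 - (c 0 * d 4 - c 4 * d 0) * e 1
        + (c 1 * d 4 - c 4 * d 1) * e 0)
      - (a 2 * b 4 - a 4 * b 2) * ((c 0 * d 1 - c 1 * d 0) * e 3 - (c 0 * d 3 - c 3 * d 0) * e 1
        + (c 1 * d 3 - c 3 * d 1) * e 0)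
      + (a 3 * b 4 - a 4 * b 3) * ((c 0 * d 1 - c 1 * d 0) * e 2 - (c 0 * d 2 - c 2 * d 0) * e 1
        + (c 1 * d 2 - c 2 * d 1) * e 0) := by
  simp [Matrix.det_succ_row_zero, Fin.sum_univ_succ, Fin.succAbove]
  ring

/-- The polarization of `quad v`. -/
def quadBilin (v : V) : (⋀[ℝ]^2 V) →ₗ[ℝ] (⋀[ℝ]^2 V) →ₗ[ℝ] ℝ :=
  LinearMap.mk₂ ℝ (fun w w' => volForm
      ((w : ExteriorAlgebra ℝ V) * (w' : ExteriorAlgebra ℝ V) * ExteriorAlgebra.ι ℝ v))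
    (fun a b c => by rw [Submodule.coe_add, add_mul, add_mul, map_add])
    (fun r a b => by rw [Submodule.coe_smul, smul_mul_assoc, smul_mul_assoc, map_smul])
    (fun a b c => by rw [Submodule.coe_add, mul_add, add_mul, map_add])
    (fun r a b => by rw [Submodule.coe_smul, mul_smul_comm, smul_mul_assoc, map_smul])

theorem quadBilin_wedge (v a b c d : V) : quadBilin v (wedge a b) (wedge c d)
    = Matrix.det (Matrix.of ![coords a, coords b, coords c, coords d, coords v]) :=
  volForm_mul a b c d v

theorem quad_elemW (v : V) (x y z : ℝ) :
    quad v (elemW x y z) = -2 * (coords v 4 * x ^ 2 + coords v 2 * (y ^ 2 + x * z)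
      + coords v 0 * z ^ 2 - coords v 3 * (x * y) - coords v 1 * (y * z)) := by
  change quadBilin v (elemW x y z) (elemW x y z) = _
  simp only [elemW, map_add, map_sub, map_smul, LinearMap.add_apply, LinearMap.sub_apply,
    LinearMap.smul_apply, quadBilin_wedge, coords_σ₁, coords_σ₂, coords_σ₃, coords_σ₄, coords_σ₅,
    smul_eq_mul]
  generalize coords v = t
  simp [det_fin_five]
  ring

/-! ### Anisotropy on two open sets. -/

/-- `v` is anisotropic if `w ∧ w ∧ v ≠ 0` for all nonzero `w ∈ W`. -/
def Anisotropic (v : V) : Prop := ∀ w ∈ W, w ≠ 0 → quad v w ≠ 0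

theorem Anisotropic.of_map {A : V →ₗ[ℝ] V} (hA : Function.Injective (exteriorPower.map 2 A))
    (hW : ∀ w ∈ W, exteriorPower.map 2 A w ∈ W) {v : V} (h : Anisotropic (A v)) :
    Anisotropic v := by
  intro w hw hw0 h0
  refine h _ (hW w hw) ((map_ne_zero_iff _ hA).2 hw0) ?_
  rw [quad_map, h0, mul_zero]

theorem quad_zero (v : V) : quad v 0 = 0 := by simp [quad]

theorem elemW_eq_zero_iff {x y z : ℝ} : elemW x y z = 0 ↔ x = 0 ∧ y = 0 ∧ z = 0 := by
  constructor
  · intro h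
    -- At `σ₁ + σ₃ + σ₅` the form is `-2(x² + y² + z² + xz)`, which is definite; its vanishing
    -- therefore yields linear independence of the generators.
    have hq := quad_elemW (coords.symm ![1, 0, 1, 0, 1]) x y z
    rw [h, quad_zero, LinearEquiv.apply_symm_apply] at hq
    simp at hq
    have hx : x ^ 2 = 0 := by nlinarith [sq_nonneg x, sq_nonneg y, sq_nonneg z, sq_nonneg (x + z)]
    have hy : y ^ 2 = 0 := by nlinarith [sq_nonneg x, sq_nonneg y, sq_nonneg z, sq_nonneg (x + z)]
    have hz : z ^ 2 = 0 := by nlinarith [sq_nonneg x, sq_nonneg y, sq_nonneg z, sq_nonneg (x + z)]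
    exact ⟨pow_eq_zero_iff two_ne_zero |>.1 hx, pow_eq_zero_iff two_ne_zero |>.1 hy,
      pow_eq_zero_iff two_ne_zero |>.1 hz⟩
  · rintro ⟨rfl, rfl, rfl⟩
    simp [elemW]

theorem anisotropic_of_coords {v : V} (h0 : 9 / 10 < coords v 0) (h4 : 9 / 10 < coords v 4)
    (h2 : |coords v 2 - 1| < 1 / 10) (h1 : |coords v 1| < 1 / 10) (h3 : |coords v 3| < 1 / 10) :
    Anisotropic v := by
  intro w hw hw0 hq
  obtain ⟨x, y, z, rfl⟩ := (mem_W_iff w).1 hw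
  rw [quad_elemW] at hq
  apply hw0
  rw [elemW_eq_zero_iff]
  rw [abs_lt] at h1 h2 h3
  generalize coords v 0 = t₀ at *
  generalize coords v 1 = t₁ at *
  generalize coords v 2 = t₂ at *
  generalize coords v 3 = t₃ at *
  generalize coords v 4 = t₄ at *
  -- Each cross term is bounded by squares. Altogether the form divided by `-2` is at least `(3x² +
  -- 8y² + 3z²)/10`.
  have e1 : t₁ * (y * z) ≤ 1 / 20 * (y ^ 2 + z ^ 2) := by
    nlinarith [mul_nonneg (by linarith : 0 ≤ 1 / 10 - t₁) (sq_nonneg (y + z)),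
      mul_nonneg (by linarith : 0 ≤ 1 / 10 + t₁) (sq_nonneg (y - z))]
  have e3 : t₃ * (x * y) ≤ 1 / 20 * (x ^ 2 + y ^ 2) := by
    nlinarith [mul_nonneg (by linarith : 0 ≤ 1 / 10 - t₃) (sq_nonneg (x + y)),
      mul_nonneg (by linarith : 0 ≤ 1 / 10 + t₃) (sq_nonneg (x - y))]
  have e2 : -(11 / 20 * (x ^ 2 + z ^ 2)) ≤ t₂ * (x * z) := by
    nlinarith [mul_nonneg (by linarith : 0 ≤ 11 / 10 - t₂) (sq_nonneg (x - z)),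
      mul_nonneg (by linarith : 0 ≤ 11 / 10 + t₂) (sq_nonneg (x + z))]
  have e4 : 9 / 10 * x ^ 2 ≤ t₄ * x ^ 2 := by gcongr
  have e0 : 9 / 10 * z ^ 2 ≤ t₀ * z ^ 2 := by gcongr
  have e5 : 9 / 10 * y ^ 2 ≤ t₂ * y ^ 2 := by gcongr; linarith
  have hx := sq_nonneg x
  have hy := sq_nonneg y
  have hz := sq_nonneg z
  exact ⟨pow_eq_zero_iff two_ne_zero |>.1 (by linarith : x ^ 2 = 0),
    pow_eq_zero_iff two_ne_zero |>.1 (by linarith : y ^ 2 = 0),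
    pow_eq_zero_iff two_ne_zero |>.1 (by linarith : z ^ 2 = 0)⟩

theorem not_anisotropic_of_coords {v : V} (h0 : coords v 0 < 0) (h4 : 0 < coords v 4) :
    ¬ Anisotropic v := by
  intro h
  -- On `y = 0`, `z = 1` the form is, up to the factor `-2`, a quadratic polynomial in `x` whose
  -- outer coefficients have opposite signs, so it has a real root.
  have hd : 0 ≤ discrim (coords v 4) (coords v 2) (coords v 0) := by
    rw [discrim]
    nlinarith [sq_nonneg (coords v 2), mul_pos h4 (neg_pos.2 h0)]
  obtain ⟨x, hx⟩ := exists_quadratic_eq_zero h4.ne' ⟨_, (Real.mul_self_sqrt hd).symm⟩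
  refine h (elemW x 0 1) ((mem_W_iff _).2 ⟨_, _, _, rfl⟩) ?_ ?_
  · rw [Ne, elemW_eq_zero_iff]
    simp
  · rw [quad_elemW]
    linear_combination (-2) * hx

/-! ### Invariance along orbits and the contradiction. -/

theorem linearPart_toLieHom_proj (φ : G ≃ₜ* G) (x : 𝔤) :
    linearPart (toLieHom (φ : G →* G) φ.continuous) (proj W x)
      = proj W (log W (φ (exp W x))) :=
  linearPart_proj _ x

theorem anisotropic_of_anisotropic_map (φ : G ≃ₜ* G) (g : G)
    (h : Anisotropic (proj W (log W (φ g)))) : Anisotropic (proj W (log W g)) := by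
  let A := linearPart (toLieHom (φ : G →* G) φ.continuous)
  let B := linearPart (toLieHom (φ.symm : G →* G) φ.symm.continuous)
  have hBA : B ∘ₗ A = LinearMap.id := by
    ext1 v
    have h1 : A v = proj W (log W (φ (exp W (incl W v)))) :=
      linearPart_toLieHom_proj φ (incl W v)
    rw [LinearMap.comp_apply, h1]
    refine (linearPart_toLieHom_proj φ.symm _).trans ?_
    change proj W (log W (φ.symm (φ (exp W (incl W v))))) = v
    rw [ContinuousMulEquiv.symm_apply_apply]
    rfl
  -- The left inverse `B`, coming from `φ.symm`, makes `∧²A` injective.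
  refine Anisotropic.of_map (A := A) (exteriorPower.map_injective B hBA)
    (fun w hw => map_linearPart_mem _ hw) ?_
  rw [show A (proj W (log W g)) = proj W (log W (φ g)) from linearPart_toLieHom_proj φ _]
  exact h

/-- The coordinates with respect to `σ₁, …, σ₅` of the first component of a group element. -/
def groupCoords (g : G) : Fin 5 → ℝ := coords (proj W (log W g))

theorem continuous_groupCoords : Continuous groupCoords :=
  (LinearMap.continuous_of_finiteDimensional (coords.toLinearMap ∘ₗ proj W)).comp
    continuous_log

theorem groupCoords_surjective : Function.Surjective groupCoords := fun t =>
  ⟨exp W (incl W (coords.symm t)), coords.apply_symm_apply t⟩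

theorem not_dense_orbit (g : G) : ¬ Dense (Set.range fun φ : G ≃ₜ* G => φ g) := by
  intro hd
  have hc : ∀ i, Continuous fun x : G => groupCoords x i := fun i =>
    (continuous_apply i).comp continuous_groupCoords
  obtain ⟨_, ⟨h0, h4, h2, h1, h3⟩, φ, rfl⟩ := hd.inter_open_nonempty
    {x : G | 9 / 10 < groupCoords x 0 ∧ 9 / 10 < groupCoords x 4 ∧ |groupCoords x 2 - 1| < 1 / 10 ∧
      |groupCoords x 1| < 1 / 10 ∧ |groupCoords x 3| < 1 / 10}
    ((isOpen_lt continuous_const (hc 0)).inter <| (isOpen_lt continuous_const (hc 4)).inter <|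
      (isOpen_lt ((hc 2).sub continuous_const).abs continuous_const).inter <|
      (isOpen_lt (hc 1).abs continuous_const).inter (isOpen_lt (hc 3).abs continuous_const))
    (by
      obtain ⟨x, hx⟩ := groupCoords_surjective ![1, 0, 1, 0, 1]
      refine ⟨x, ?_⟩
      rw [Set.mem_ofPred_eq, hx]
      simp
      norm_num)
  obtain ⟨_, ⟨k0, k4⟩, ψ, rfl⟩ := hd.inter_open_nonempty
    {x : G | groupCoords x 0 < 0 ∧ 0 < groupCoords x 4}
    ((isOpen_lt (hc 0) continuous_const).inter (isOpen_lt continuous_const (hc 4)))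
    (by
      obtain ⟨x, hx⟩ := groupCoords_surjective ![-1, 0, 0, 0, 1]
      refine ⟨x, ?_⟩
      rw [Set.mem_ofPred_eq, hx]
      simp)
  have hg := anisotropic_of_anisotropic_map φ g (anisotropic_of_coords h0 h4 h2 h1 h3)
  -- Anisotropy is pulled back from `φ g` to `g`, then carried to `ψ g` by pulling back along
  -- `ψ.symm`.
  refine not_anisotropic_of_coords k0 k4 (anisotropic_of_anisotropic_map ψ.symm (ψ g) ?_)
  rwa [ContinuousMulEquiv.symm_apply_apply]

/-! ### Dimensions and nilpotency class. -/

theorem finrank_V : Module.finrank ℝ V = 5 := by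
  rw [Module.finrank_eq_card_basis basisV, Fintype.card_fin]

theorem finrank_W : Module.finrank ℝ W = 3 := by
  let u : Fin 3 → ⋀[ℝ]^2 V :=
    ![wedge σ₁ σ₄ - wedge σ₂ σ₃, wedge σ₁ σ₅ - wedge σ₂ σ₄, wedge σ₂ σ₅ - wedge σ₃ σ₄]
  have hu : LinearIndependent ℝ u := by
    rw [Fintype.linearIndependent_iff]
    intro c hc
    rw [Fin.sum_univ_three] at hc
    obtain ⟨h0, h1, h2⟩ := elemW_eq_zero_iff.1 hc
    intro i
    fin_cases i <;> assumption
  have hW : W = Submodule.span ℝ (Set.range u) := by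
    rw [W, Matrix.range_cons, Matrix.range_cons, Matrix.range_cons, Matrix.range_empty,
      Set.union_empty]
    rfl
  rw [hW, finrank_span_eq_card hu, Fintype.card_fin]

theorem finrank_exteriorPower_V : Module.finrank ℝ (⋀[ℝ]^2 V) = 10 := by
  rw [exteriorPower.finrank_eq, finrank_V]
  rfl

theorem finrank_quotient_W : Module.finrank ℝ ((⋀[ℝ]^2 V) ⧸ W) = 7 := by
  have h := W.finrank_quotient_add_finrank
  rw [finrank_W, finrank_exteriorPower_V] at h
  omega

theorem finrank_𝔤 : Module.finrank ℝ 𝔤 = 12 := by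
  refine (Module.finrank_prod (R := ℝ) (M := V) (M' := (⋀[ℝ]^2 V) ⧸ W)).trans ?_
  rw [finrank_V, finrank_quotient_W]

/-- Brackets span the second summand, which has dimension `7`, so they cannot all vanish. -/
theorem exists_lie_ne_zero : ∃ x y : 𝔤, ⁅x, y⁆ ≠ 0 := by
  by_contra! h
  have : Subsingleton ((⋀[ℝ]^2 V) ⧸ W) := by
    refine subsingleton_of_forall_eq 0 fun z => ?_
    have hz := inclSnd_mem_span_lie W z
    rw [Submodule.span_eq_bot.2 (by rintro _ ⟨p, rfl⟩; exact h _ _), Submodule.mem_bot] at hz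
    exact congrArg Prod.snd hz
  have h7 := finrank_quotient_W
  rw [Module.finrank_zero_of_subsingleton] at h7
  omega

theorem nilpotencyLength_𝔤 : LieModule.nilpotencyLength 𝔤 𝔤 = 2 := by
  rw [LieModule.nilpotencyLength_eq_succ_iff ℝ]
  constructor
  · rw [LieModule.lowerCentralSeries_succ, LieSubmodule.lie_eq_bot_iff]
    intro x _ m hm
    suffices LieModule.lowerCentralSeries ℝ 𝔤 𝔤 1 ≤ LieModule.maxTrivSubmodule ℝ 𝔤 𝔤 from
      (LieModule.mem_maxTrivSubmodule ℝ 𝔤 𝔤 m).1 (this hm) x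
    rw [LieModule.lowerCentralSeries_succ, LieSubmodule.lie_le_iff]
    intro y _ n _
    rw [LieModule.mem_maxTrivSubmodule]
    exact fun z => lie_lie_eq_zero W z y n
  · rw [Ne, ← LieModule.trivial_iff_lower_central_eq_bot]
    intro h
    obtain ⟨x, y, hxy⟩ := exists_lie_ne_zero
    exact hxy (h.trivial x y)

end TwoStep

end

theorem mainTheorem2 :
    Module.finrank ℝ TwoStep.𝔤 = 12 ∧
    LieModule.nilpotencyLength TwoStep.𝔤 TwoStep.𝔤 = 2 ∧
    SimplyConnectedSpace TwoStep.G ∧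
    Nonempty (GroupLieAlgebra 𝓘(ℝ, TwoStep.𝔤) TwoStep.G ≃ₗ⁅ℝ⁆ TwoStep.𝔤) ∧
    ∀ g : TwoStep.G, ¬ Dense (Set.range fun φ : TwoStep.G ≃ₜ* TwoStep.G => φ g) :=
  ⟨TwoStep.finrank_𝔤, TwoStep.nilpotencyLength_𝔤, inferInstance,
    ⟨TwoStep.groupLieAlgebraEquiv TwoStep.W⟩, TwoStep.not_dense_orbit⟩
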